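/- Let $\mathcal A$ be an abelian category with small hom-sets which is \emph{quasi-locally presentable}: there are full subcategories $\mathcal A_\lambda\subseteq\mathcal A$, one for each regular (infinite) cardinal $\lambda$, with $\mathcal A=\bigcup_\lambda\mathcal A_\lambda$, such that each $\mathcal A_\lambda$ is locally $\lambda$-presentable and closed under (small) colimits in $\mathcal A$, the inclusion $\mathcal A_\lambda\to\mathcal A$ preserving colimits. Write $\mathcal A_\lambda^\lambda$ for the class of objects of $\mathcal A_\lambda$ that are $\lambda$-presentable in $\mathcal A_\lambda$. Let $\kappa$ be a regular cardinal. Suppose that: 1. the family is increasing from $\kappa$ on, in the sense that $\mathcal A_\mu^\mu\subseteq\mathcal A_\lambda^\lambda$ (and hence also $\mathcal A_\mu\subseteq\mathcal A_\lambda$) for all regular cardinals $\kappa\le\mu\le\lambda$; 2. $\mathcal A$ is \emph{weakly $\kappa$-generated}: the smallest full subcategory of $\mathcal A$ that contains $\mathcal A_\kappa$ and is closed under kernels, cokernels, extensions and countable coproducts is $\mathcal A$ itself; 3. for every regular cardinal $\lambda\ge\kappa$, every $X\in\mathcal A_\lambda^\lambda$ admits a monomorphism $X\to S$ in $\mathcal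 A$ into an object $S\in\mathcal A_\lambda^\lambda$ that is injective in $\mathcal A$. Then every exact contravariant functor $F:\mathcal A\to\mathrm{Ab}$ that sends coproducts to products is representable: there are an object $Z$ of $\mathcal A$ and a natural isomorphism of $\mathrm{Ab}$-valued functors $F\cong\mathcal A(-,Z)$. Moreover, every object representing $F$ is injective. -/

import Mathlib

universe w u

namespace QuasiLocPres

open CategoryTheory CategoryTheory.Limits

variable {A : Type u} [Category.{w} A]

/-- The family `𝒜` of full subcategories (only its values at regular cardinals matter) exhibits
`A` as a quasi-locally presentable category: for every regular cardinal `μ` the subcategory `𝒜 μ`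
is locally `μ`-presentable and closed under colimits in `A` (small colimits of objects of `𝒜 μ`,
formed in `A`, lie in `𝒜 μ`, and the inclusion functor preserves colimits), and every object
of `A` lies in some `𝒜 μ`. -/
structure IsQuasiLocallyPresentable (𝒜 : Cardinal.{w} → ObjectProperty A) : Prop where
  locallyPresentable (μ : Cardinal.{w}) [Fact μ.IsRegular] :
    IsCardinalLocallyPresentable (𝒜 μ).FullSubcategory μ
  closedUnderColimits (μ : Cardinal.{w}) [Fact μ.IsRegular] (J : Type w) [SmallCategory J] :
    (𝒜 μ).IsClosedUnderColimitsOfShape J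
  preservesColimits (μ : Cardinal.{w}) [Fact μ.IsRegular] :
    PreservesColimitsOfSize.{w, w} (𝒜 μ).ι
  exists_mem (X : A) : ∃ μ : Cardinal.{w}, μ.IsRegular ∧ 𝒜 μ X

/-- The objects of `𝒜 μ` that are `μ`-presentable in the category `𝒜 μ`. -/
def presentablePart (𝒜 : Cardinal.{w} → ObjectProperty A) (μ : Cardinal.{w})
    [Fact μ.IsRegular] : ObjectProperty A :=
  fun X => ∃ h : 𝒜 μ X, IsCardinalPresentable (⟨X, h⟩ : (𝒜 μ).FullSubcategory) μ

/-- The injective objects of `A` that lie in `𝒜 μ` and are `μ`-presentable there. -/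
def injectivePart (𝒜 : Cardinal.{w} → ObjectProperty A) (μ : Cardinal.{w})
    [Fact μ.IsRegular] : ObjectProperty A :=
  fun S => Injective S ∧ presentablePart 𝒜 μ S

/-- `A` coincides with its smallest full subcategory containing `𝒜 κ` and closed under kernels,
cokernels, extensions and countable coproducts. -/
def IsWeaklyGenerated [Abelian A] (𝒜 : Cardinal.{w} → ObjectProperty A) (κ : Cardinal.{w}) :
    Prop :=
  ∀ P : ObjectProperty A, 𝒜 κ ≤ P →
    P.IsClosedUnderKernels → P.IsClosedUnderCokernels → P.IsClosedUnderExtensions →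
    (∀ (J : Type) [Countable J], P.IsClosedUnderColimitsOfShape (Discrete J)) →
    ∀ X : A, P X

end QuasiLocPres

/-!
The objects that are `μ`-presentable in `𝒜 μ` for some `μ ≥ κ` are closed under small colimits. Over
them, one builds a long chain in the category of elements of `F`: it starts at a coproduct of all
elements of `F` over a small generator of `𝒜 κ`, and each step first kills the morphisms from the
generator that induce `0` and then embeds into an injective object. Let `C_j` be the objects of the
chain, and consider the `X` for which `colim_j Hom(X, C_j) → F X` is bijective. They include the
small colimits of objects of the generator, and are closed under cokernels, under kernels and
extensions (where the injective objects allow lifting) and under coproducts of fewer objects than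
the cofinality of the chain. So all objects of `A` are of this kind. For the colimit `C` of the
chain and its element `t`, this means that every element of `F` is induced from `t`, and that `t`
itself is induced by a morphism `C ⟶ C_j`. The resulting endomorphism of `C` is idempotent, and its
image represents `F`.
-/

namespace QuasiLocPres

open CategoryTheory CategoryTheory.Limits Opposite

variable {A : Type u} [Category.{w} A]

/-- The objects of `A` that are colimits of small diagrams of objects satisfying `Q`. -/
def smallColimits (Q : ObjectProperty A) : ObjectProperty A :=
  fun X => ∃ (J : Type w) (_ : SmallCategory J), Q.colimitsOfShape J X

/-- The full subcategory of `A` given by `P` is closed under small colimits formed in `A`, all of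
which exist; `A` itself need not be cocomplete. -/
structure IsCocompleteSubcategory (P : ObjectProperty A) : Prop where
  hasColimit {J : Type w} [SmallCategory J] (D : J ⥤ A) (hD : ∀ j, P (D.obj j)) : HasColimit D
  isClosedUnderColimitsOfShape (J : Type w) [SmallCategory J] : P.IsClosedUnderColimitsOfShape J

namespace IsCocompleteSubcategory

variable {P : ObjectProperty A}

/-- The inclusion of a cocomplete subcategory creates small colimits. -/
noncomputable abbrev createsColimit (hP : IsCocompleteSubcategory P) {J : Type w} [SmallCategory J]
    (D : J ⥤ P.FullSubcategory) : CreatesColimit D P.ι :=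
  have := hP.isClosedUnderColimitsOfShape J
  have := hP.hasColimit (D ⋙ P.ι) fun j => (D.obj j).property
  createsColimitFullSubcategoryInclusionOfClosed J P D

lemma hasColimits (hP : IsCocompleteSubcategory P) :
    HasColimitsOfSize.{w, w} P.FullSubcategory where
  has_colimits_of_shape _ _ :=
    { has_colimit := fun D =>
        have := hP.hasColimit (D ⋙ P.ι) fun j => (D.obj j).property
        have := hP.createsColimit D
        hasColimit_of_created D P.ι }

lemma preservesColimits_ι (hP : IsCocompleteSubcategory P) :
    PreservesColimitsOfSize.{w, w} P.ι where
  preservesColimitsOfShape :=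
    { preservesColimit := fun {D} =>
        have := hP.hasColimit (D ⋙ P.ι) fun j => (D.obj j).property
        have := hP.createsColimit D
        inferInstance }

lemma prop_cokernel [HasZeroMorphisms A] (hP : IsCocompleteSubcategory P) {X Y : A} (f : X ⟶ Y)
    [HasCokernel f] (hX : P X) (hY : P Y) : P (cokernel f) := by
  have := hP.isClosedUnderColimitsOfShape (AsSmall.{w} WalkingParallelPair)
  have : P.IsClosedUnderColimitsOfShape WalkingParallelPair :=
    .of_equivalence AsSmall.equiv.symm
  exact P.prop_colimit _ (by rintro (_ | _) <;> assumption)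

end IsCocompleteSubcategory

section Presentable

variable {𝒜 : Cardinal.{w} → ObjectProperty A} {κ : Cardinal.{w}}

/-- From `κ` on, the classes of `μ`-presentable objects of `𝒜 μ` increase with `μ`. -/
def IsIncreasingFrom (𝒜 : Cardinal.{w} → ObjectProperty A) (κ : Cardinal.{w}) : Prop :=
  ∀ (μ ν : Cardinal.{w}) [Fact μ.IsRegular] [Fact ν.IsRegular], κ ≤ μ → μ ≤ ν →
    presentablePart 𝒜 μ ≤ presentablePart 𝒜 ν

/-- The objects of `A` that are `μ`-presentable in `𝒜 μ` for some regular cardinal `μ ≥ κ`: the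
cocomplete subcategory in which the objects representing `F` are approximated. -/
def eventuallyPresentable (𝒜 : Cardinal.{w} → ObjectProperty A) (κ : Cardinal.{w}) :
    ObjectProperty A :=
  fun X => ∃ (μ : Cardinal.{w}) (_ : Fact μ.IsRegular), κ ≤ μ ∧ presentablePart 𝒜 μ X

lemma presentablePart_le_eventuallyPresentable {μ : Cardinal.{w}} [Fact μ.IsRegular]
    (hμ : κ ≤ μ) : presentablePart 𝒜 μ ≤ eventuallyPresentable 𝒜 κ :=
  fun _ hX => ⟨μ, inferInstance, hμ, hX⟩

lemma IsQuasiLocallyPresentable.hasColimit (hA : IsQuasiLocallyPresentable 𝒜) (μ : Cardinal.{w})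
    [Fact μ.IsRegular] {J : Type w} [SmallCategory J] (D : J ⥤ A) (hD : ∀ j, 𝒜 μ (D.obj j)) :
    HasColimit D := by
  have := hA.locallyPresentable μ
  have := hA.preservesColimits μ
  exact inferInstanceAs (HasColimit ((𝒜 μ).lift D hD ⋙ (𝒜 μ).ι))

lemma IsQuasiLocallyPresentable.presentablePart_of_isColimit (hA : IsQuasiLocallyPresentable 𝒜)
    (μ : Cardinal.{w}) [Fact μ.IsRegular] {J : Type w} [SmallCategory J]
    (hJ : HasCardinalLT (Arrow J) μ) {D : J ⥤ A} {c : Cocone D} (hc : IsColimit c)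
    (hD : ∀ j, presentablePart 𝒜 μ (D.obj j)) : presentablePart 𝒜 μ c.pt := by
  have := hA.closedUnderColimits μ J
  have := hA.locallyPresentable μ
  choose hmem hpres using hD
  have hpt : 𝒜 μ c.pt := (𝒜 μ).prop_of_isColimit hc hmem
  let D' : J ⥤ (𝒜 μ).FullSubcategory := (𝒜 μ).lift D hmem
  let c' : Cocone D' :=
    { pt := ⟨c.pt, hpt⟩
      ι := { app := fun j => ObjectProperty.homMk (c.ι.app j)
             naturality := fun _ _ f => by
              ext
              exact c.ι.naturality f } }
  have hc' : IsColimit c' := isColimitOfReflects (𝒜 μ).ι (c := c') hc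
  have : ∀ j, IsCardinalPresentable (D'.obj j) μ := hpres
  exact ⟨hpt, isCardinalPresentable_of_isColimit c' hc' μ hJ⟩

lemma exists_isRegular_forall_lt {I : Type w} (m : I → Cardinal.{w}) (c : Cardinal.{w}) :
    ∃ ν : Cardinal.{w}, ν.IsRegular ∧ c < ν ∧ ∀ i, m i < ν :=
  ⟨Order.succ (max Cardinal.aleph0 (max c (⨆ i, m i))), Cardinal.isRegular_succ (le_max_left _ _),
    Order.lt_succ_of_le (by simp), fun i => Order.lt_succ_of_le
      ((le_ciSup (Cardinal.bddAbove_of_small) i).trans (by simp))⟩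

lemma IsIncreasingFrom.exists_forall_presentablePart (hinc : IsIncreasingFrom 𝒜 κ)
    {I : Type w} {X : I → A} (hX : ∀ i, eventuallyPresentable 𝒜 κ (X i)) (c : Cardinal.{w}) :
    ∃ (ν : Cardinal.{w}) (_ : Fact ν.IsRegular), κ ≤ ν ∧ c < ν ∧
      ∀ i, presentablePart 𝒜 ν (X i) := by
  choose m _ hκm hm using hX
  obtain ⟨ν, hν, hcν, hmν⟩ := exists_isRegular_forall_lt m (max κ c)
  have : Fact ν.IsRegular := ⟨hν⟩
  exact ⟨ν, this, (le_max_left _ _).trans hcν.le, (le_max_right _ _).trans_lt hcν,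
    fun i => hinc (m i) ν (hκm i) (hmν i).le _ (hm i)⟩

lemma isCocompleteSubcategory_eventuallyPresentable (hA : IsQuasiLocallyPresentable 𝒜)
    (hinc : IsIncreasingFrom 𝒜 κ) : IsCocompleteSubcategory (eventuallyPresentable 𝒜 κ) where
  hasColimit D hD := by
    obtain ⟨ν, _, -, -, hν⟩ := hinc.exists_forall_presentablePart hD 0
    exact hA.hasColimit ν D fun j => (hν j).1
  isClosedUnderColimitsOfShape J _ :=
    { colimitsOfShape_le := by
        rintro X ⟨p⟩
        obtain ⟨ν, _, hκν, hJν, hν⟩ :=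
          hinc.exists_forall_presentablePart p.prop_diag_obj (Cardinal.mk (Arrow J))
        exact presentablePart_le_eventuallyPresentable hκν _
          (hA.presentablePart_of_isColimit ν ((hasCardinalLT_iff_cardinal_mk_lt _ _).2 hJν)
            p.isColimit hν) }

lemma IsQuasiLocallyPresentable.exists_small_le_smallColimits [Fact κ.IsRegular]
    (hA : IsQuasiLocallyPresentable 𝒜) :
    ∃ (Q : ObjectProperty A) (_ : ObjectProperty.Small.{w} Q),
      Q ≤ presentablePart 𝒜 κ ∧ 𝒜 κ ≤ smallColimits Q := by
  have := hA.locallyPresentable κ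
  have := hA.preservesColimits κ
  obtain ⟨Q, _, hQ⟩ :=
    HasCardinalFilteredGenerator.exists_small_generator (𝒜 κ).FullSubcategory κ
  refine ⟨Q.strictMap (𝒜 κ).ι, inferInstance, ?_, fun X hX => ?_⟩
  · rintro _ ⟨X, hX⟩
    exact ⟨X.property, hQ.le_isCardinalPresentable _ hX⟩
  · obtain ⟨J, _, _, ⟨p⟩⟩ := hQ.exists_colimitsOfShape ⟨X, hX⟩
    exact ⟨J, inferInstance,
      ⟨{ toColimitPresentation := p.toColimitPresentation.map (𝒜 κ).ι
         prop_diag_obj := fun j => Q.strictMap_obj _ (p.prop_diag_obj j) }⟩⟩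

end Presentable

/-- `A` is the smallest full subcategory of `A` containing the objects of `G` and closed under
kernels, cokernels, extensions and coproducts of fewer than `α` objects. -/
def IsWeaklyGeneratedBelow [Abelian A] (G : ObjectProperty A) (α : Cardinal.{w}) : Prop :=
  ∀ P : ObjectProperty A, G ≤ P →
    P.IsClosedUnderKernels → P.IsClosedUnderCokernels → P.IsClosedUnderExtensions →
    (∀ J : Type w, HasCardinalLT J α → P.IsClosedUnderColimitsOfShape (Discrete J)) →
    ∀ X : A, P X

lemma IsWeaklyGeneratedBelow.mono [Abelian A] {G G' : ObjectProperty A} {α : Cardinal.{w}}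
    (hG : IsWeaklyGeneratedBelow G α) (h : G ≤ G') : IsWeaklyGeneratedBelow G' α :=
  fun P hP => hG P (h.trans hP)

lemma IsWeaklyGenerated.isWeaklyGeneratedBelow_aleph_one [Abelian A]
    {𝒜 : Cardinal.{w} → ObjectProperty A} {κ : Cardinal.{w}} (h : IsWeaklyGenerated 𝒜 κ) :
    IsWeaklyGeneratedBelow (𝒜 κ) (Cardinal.aleph 1) := by
  refine fun P hP hker hcoker hext hcoprod => h P hP hker hcoker hext fun J _ => ?_
  have := hcoprod (ULift J) (by
    rw [hasCardinalLT_iff_cardinal_mk_lt, Cardinal.lt_aleph_one_iff]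
    exact Cardinal.mk_le_aleph0)
  exact .of_equivalence (Discrete.equivalence Equiv.ulift)

section Pull

variable (F : Aᵒᵖ ⥤ AddCommGrpCat.{w})

/-- The homomorphism `F Y → F X` induced by a morphism `X ⟶ Y`. -/
def pull {X Y : A} (f : X ⟶ Y) : F.obj (op Y) →+ F.obj (op X) := (F.map f.op).hom

@[simp]
lemma pull_id {X : A} (x : F.obj (op X)) : pull F (𝟙 X) x = x := by
  simp [pull]

@[simp]
lemma pull_comp {X Y Z : A} (f : X ⟶ Y) (g : Y ⟶ Z) (x : F.obj (op Z)) :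
    pull F (f ≫ g) x = pull F f (pull F g x) := by
  simp [pull]

lemma pull_injective [F.PreservesMonomorphisms] {X Y : A} (f : X ⟶ Y) [Epi f] :
    Function.Injective (pull F f) :=
  (AddCommGrpCat.mono_iff_injective (F.map f.op)).1 inferInstance

lemma pull_surjective [F.PreservesEpimorphisms] {X Y : A} (f : X ⟶ Y) [Mono f] :
    Function.Surjective (pull F f) :=
  (AddCommGrpCat.epi_iff_surjective (F.map f.op)).1 inferInstance

lemma pull_ext_of_isColimit_discrete {I : Type w} [PreservesLimitsOfShape (Discrete I) F]
    {D : Discrete I ⥤ A} {c : Cocone D} (hc : IsColimit c) {x y : F.obj (op c.pt)}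
    (hxy : ∀ i, pull F (c.ι.app i) x = pull F (c.ι.app i) y) : x = y := by
  have : PreservesLimitsOfShape (Discrete I)ᵒᵖ F :=
    preservesLimitsOfShape_of_equiv (Discrete.opposite I).symm F
  exact Concrete.isLimit_ext _ (isLimitOfPreserves F hc.op) x y fun i => hxy i.unop

lemma pull_ext_of_isColimit [F.PreservesMonomorphisms] {J : Type w} [SmallCategory J]
    [PreservesLimitsOfShape (Discrete J) F] {D : J ⥤ A} [HasCoproduct D.obj] {c : Cocone D}
    (hc : IsColimit c) {x y : F.obj (op c.pt)}
    (hxy : ∀ j, pull F (c.ι.app j) x = pull F (c.ι.app j) y) : x = y := by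
  let q : ∐ D.obj ⟶ c.pt := Sigma.desc c.ι.app
  have : Epi q := ⟨fun u v huv => hc.hom_ext fun j => by simpa [q] using Sigma.ι D.obj j ≫= huv⟩
  refine pull_injective F q (pull_ext_of_isColimit_discrete F (coproductIsCoproduct _) fun j => ?_)
  have hq : (Cofan.mk _ (Sigma.ι D.obj)).ι.app j ≫ q = c.ι.app j.as := Sigma.ι_desc _ _
  rw [← pull_comp, ← pull_comp, hq, hxy]

section Additive

variable [Preadditive A] [F.Additive] {X Y : A}

@[simp]
lemma pull_add_hom (f g : X ⟶ Y) (x : F.obj (op Y)) :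
    pull F (f + g) x = pull F f x + pull F g x := by
  simp [pull]

@[simp]
lemma pull_sub_hom (f g : X ⟶ Y) (x : F.obj (op Y)) :
    pull F (f - g) x = pull F f x - pull F g x := by
  simp [pull]

@[simp]
lemma pull_zero_hom (x : F.obj (op Y)) : pull F (0 : X ⟶ Y) x = 0 := by
  simp [pull]

end Additive

lemma exists_pull_eq_of_exact [Abelian A] [F.Additive] [PreservesFiniteLimits F]
    [PreservesFiniteColimits F] {S : ShortComplex A} (hS : S.Exact) {x : F.obj (op S.X₂)}
    (hx : pull F S.f x = 0) : ∃ y, pull F S.g y = x :=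
  (ShortComplex.ab_exact_iff _).1 (hS.op.map F) x hx

end Pull

section Representability

variable [Preadditive A] {F : Aᵒᵖ ⥤ AddCommGrpCat.{w}}

lemma nonempty_iso_preadditiveYoneda_of_bijective [F.Additive] {Z : A} (z : F.obj (op Z))
    (hz : ∀ X : A, Function.Bijective fun f : X ⟶ Z => pull F f z) :
    Nonempty (F ≅ preadditiveYoneda.obj Z) := by
  let φ (X : Aᵒᵖ) : (preadditiveYoneda.obj Z).obj X ≅ F.obj X :=
    AddEquiv.toAddCommGrpIso (X := (preadditiveYoneda.obj Z).obj X)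
      (AddEquiv.ofBijective (AddMonoidHom.mk' (fun f : X.unop ⟶ Z => pull F f z)
        fun f g => pull_add_hom F f g z) (hz X.unop))
  refine ⟨(NatIso.ofComponents φ fun a => ?_).symm⟩
  ext f
  exact pull_comp F a.unop f z

/-- The image of `e`, which is idempotent because `e - 𝟙` is annihilated by `e`, represents `F`. -/
lemma exists_iso_preadditiveYoneda_of_surjective [F.Additive] [IsIdempotentComplete A] {C : A}
    (t : F.obj (op C)) (ht : ∀ (X : A) (x : F.obj (op X)), ∃ f : X ⟶ C, pull F f t = x)
    (e : C ⟶ C) (het : pull F e t = t)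
    (he : ∀ {X : A} (f : X ⟶ C), pull F f t = 0 → f ≫ e = 0) :
    ∃ Z : A, Nonempty (F ≅ preadditiveYoneda.obj Z) := by
  have idem : e ≫ e = e := by
    have hzero := he (e - 𝟙 C) (by simp [het])
    rwa [Preadditive.sub_comp, Category.id_comp, sub_eq_zero] at hzero
  obtain ⟨Z, m, p, hmp, hpm⟩ := IsIdempotentComplete.idempotents_split C e idem
  refine ⟨Z, nonempty_iso_preadditiveYoneda_of_bijective (pull F m t) fun X => ⟨?_, fun x => ?_⟩⟩
  · intro f g hfg
    have hzero : (f - g) ≫ m ≫ e = 0 := by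
      simpa using he ((f - g) ≫ m) (by simpa [sub_eq_zero] using hfg)
    rw [← hpm, reassoc_of% hmp, Preadditive.sub_comp, sub_eq_zero] at hzero
    simpa [hmp] using hzero =≫ p
  · obtain ⟨f, rfl⟩ := ht X x
    exact ⟨f ≫ p, by simp only [pull_comp, ← pull_comp F p m, hpm, het]⟩

lemma injective_of_iso_preadditiveYoneda [F.PreservesEpimorphisms] {Z : A}
    (e : F ≅ preadditiveYoneda.obj Z) : Injective Z := by
  rw [Injective.injective_iff_preservesEpimorphisms_preadditiveYoneda_obj]
  exact Functor.PreservesEpimorphisms.of_iso e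

end Representability

/-- A diagram in `A` together with a compatible family of elements of the values of `F`, i.e. a
diagram in the category of elements of `F`. -/
structure ElementSystem (F : Aᵒᵖ ⥤ AddCommGrpCat.{w}) (J : Type*) [Category* J] where
  /-- the underlying diagram -/
  diag : J ⥤ A
  /-- the compatible family of elements -/
  elt (j : J) : F.obj (op (diag.obj j))
  pull_elt {i j : J} (a : i ⟶ j) : pull F (diag.map a) (elt j) = elt i

namespace ElementSystem

attribute [simp] pull_elt

section

variable {F : Aᵒᵖ ⥤ AddCommGrpCat.{w}} {J : Type*} [Category* J] (σ : ElementSystem F J)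

/-- The elements of the system are induced by one element over the vertex of a cocone. -/
def IsAmalgamated : Prop :=
  ∃ (c : Cocone σ.diag) (t : F.obj (op c.pt)), ∀ j, pull F (c.ι.app j) t = σ.elt j

/-- Every object of the diagram maps to an injective one within the diagram. -/
def HasCofinalInjectives : Prop :=
  ∀ i : J, ∃ (j : J) (_ : i ⟶ j), Injective (σ.diag.obj j)

variable {σ} in
lemma HasCofinalInjectives.exists_extension (hσ : σ.HasCofinalInjectives) {X Y : A} (m : X ⟶ Y)
    [Mono m] {i : J} (f : X ⟶ σ.diag.obj i) :
    ∃ (j : J) (a : i ⟶ j) (g : Y ⟶ σ.diag.obj j), m ≫ g = f ≫ σ.diag.map a := by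
  obtain ⟨j, a, _⟩ := hσ i
  exact ⟨j, a, Injective.factorThru (f ≫ σ.diag.map a) m, Injective.comp_factorThru _ _⟩

/-- The canonical map to `F X` from the colimit over `j` of the groups `X ⟶ σ.diag.obj j` is
bijective; for injectivity, this is spelled out for filtered `J` and additive `F`. -/
structure Detects [HasZeroMorphisms A] (X : A) : Prop where
  exists_pull_eq (x : F.obj (op X)) :
    ∃ (j : J) (f : X ⟶ σ.diag.obj j), pull F f (σ.elt j) = x
  exists_comp_map_eq_zero {i : J} {f : X ⟶ σ.diag.obj i} (hf : pull F f (σ.elt i) = 0) :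
    ∃ (j : J) (a : i ⟶ j), f ≫ σ.diag.map a = 0

/-- Uniformly over the objects `X` of `Q`, some stage of the system induces all elements of `F X`,
and the morphisms from `X` to a given stage that induce `0` become zero at a later stage. -/
structure IsExhaustive [HasZeroMorphisms A] (Q : ObjectProperty A) : Prop where
  exists_forall_pull_eq : ∃ i : J, ∀ ⦃X : A⦄, Q X → ∀ x : F.obj (op X),
    ∃ f : X ⟶ σ.diag.obj i, pull F f (σ.elt i) = x
  exists_forall_comp_map_eq_zero (i : J) : ∃ (j : J) (a : i ⟶ j), ∀ ⦃X : A⦄, Q X →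
    ∀ f : X ⟶ σ.diag.obj i, pull F f (σ.elt i) = 0 → f ≫ σ.diag.map a = 0

end

section Closure

variable [Abelian A] {F : Aᵒᵖ ⥤ AddCommGrpCat.{w}} [F.Additive] {J : Type*} [Category* J]
  {σ : ElementSystem F J}

lemma Detects.exists_comp_map_eq [IsFilteredOrEmpty J] {X : A} (hX : σ.Detects X) {i j : J}
    {f : X ⟶ σ.diag.obj i} {g : X ⟶ σ.diag.obj j}
    (h : pull F f (σ.elt i) = pull F g (σ.elt j)) :
    ∃ (k : J) (a : i ⟶ k) (b : j ⟶ k), f ≫ σ.diag.map a = g ≫ σ.diag.map b := by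
  obtain ⟨k, c, hc⟩ := hX.exists_comp_map_eq_zero (i := IsFiltered.max i j)
    (f := f ≫ σ.diag.map (IsFiltered.leftToMax i j) - g ≫ σ.diag.map (IsFiltered.rightToMax i j))
    (by simp [h])
  refine ⟨k, IsFiltered.leftToMax i j ≫ c, IsFiltered.rightToMax i j ≫ c, ?_⟩
  simpa [Preadditive.sub_comp, sub_eq_zero] using hc

lemma Detects.of_isColimit_cokernelCofork [F.PreservesMonomorphisms] {X Y : A} {f : X ⟶ Y}
    {c : CokernelCofork f} (hc : IsColimit c) (hX : σ.Detects X) (hY : σ.Detects Y) :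
    σ.Detects c.pt := by
  have : Epi c.π := Cofork.IsColimit.epi hc
  refine ⟨fun x => ?_, fun {i g} hg => ?_⟩
  · obtain ⟨i, g, hg⟩ := hY.exists_pull_eq (pull F c.π x)
    obtain ⟨j, a, ha⟩ := hX.exists_comp_map_eq_zero (f := f ≫ g) (by
      rw [pull_comp, hg, ← pull_comp, c.condition, pull_zero_hom])
    obtain ⟨g', hg'⟩ := CokernelCofork.IsColimit.desc' hc (g ≫ σ.diag.map a) (by simpa using ha)
    refine ⟨j, g', pull_injective F c.π ?_⟩
    rw [← pull_comp, hg', pull_comp, pull_elt, hg]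
  · obtain ⟨j, a, ha⟩ := hY.exists_comp_map_eq_zero (f := c.π ≫ g) (by
      rw [pull_comp, hg, map_zero])
    exact ⟨j, a, by rw [← cancel_epi c.π, comp_zero, ← ha, Category.assoc]⟩

lemma Detects.of_isLimit_kernelFork [PreservesFiniteLimits F] [PreservesFiniteColimits F]
    [IsFilteredOrEmpty J] (hσ : σ.HasCofinalInjectives) {X Y : A} {f : X ⟶ Y} {c : KernelFork f}
    (hc : IsLimit c) (hX : σ.Detects X) (hY : σ.Detects Y) : σ.Detects c.pt := by
  have : Mono c.ι := Fork.IsLimit.mono hc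
  refine ⟨fun x => ?_, fun {i g} hg => ?_⟩
  · obtain ⟨y, rfl⟩ := pull_surjective F c.ι x
    obtain ⟨i, g, rfl⟩ := hX.exists_pull_eq y
    exact ⟨i, c.ι ≫ g, pull_comp F _ _ _⟩
  · obtain ⟨j, a, g', hg'⟩ := hσ.exists_extension c.ι g
    have exact_c : (ShortComplex.mk c.ι f c.condition).Exact :=
      ShortComplex.exact_of_f_is_kernel _
        (IsLimit.ofIsoLimit hc (Fork.ext (Iso.refl _) (by simp)))
    obtain ⟨y, hy⟩ := exists_pull_eq_of_exact F exact_c (x := pull F g' (σ.elt j)) (by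
      dsimp only
      rw [← pull_comp, hg', pull_comp, pull_elt, hg])
    obtain ⟨k, h, rfl⟩ := hY.exists_pull_eq y
    obtain ⟨l, b, b', hb⟩ := hX.exists_comp_map_eq (f := g') (g := f ≫ h) (by rw [pull_comp, ← hy])
    refine ⟨l, a ≫ b, ?_⟩
    calc g ≫ σ.diag.map (a ≫ b) = c.ι ≫ g' ≫ σ.diag.map b := by
          rw [Functor.map_comp, reassoc_of% hg']
      _ = (c.ι ≫ f) ≫ h ≫ σ.diag.map b' := by rw [hb, Category.assoc, Category.assoc]
      _ = 0 := by rw [c.condition, zero_comp]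

lemma Detects.of_shortExact [PreservesFiniteLimits F] [PreservesFiniteColimits F]
    [IsFilteredOrEmpty J] (hσ : σ.HasCofinalInjectives) {S : ShortComplex A} (hS : S.ShortExact)
    (h₁ : σ.Detects S.X₁) (h₃ : σ.Detects S.X₃) : σ.Detects S.X₂ := by
  have := hS.mono_f
  have := hS.epi_g
  refine ⟨fun x => ?_, fun {i f} hf => ?_⟩
  · obtain ⟨i, f, hf⟩ := h₁.exists_pull_eq (pull F S.f x)
    obtain ⟨j, a, f', hf'⟩ := hσ.exists_extension S.f f
    obtain ⟨y, hy⟩ := exists_pull_eq_of_exact F hS.exact (x := x - pull F f' (σ.elt j)) (by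
      rw [map_sub, ← pull_comp, hf', pull_comp, pull_elt, hf, sub_self])
    obtain ⟨k, g, rfl⟩ := h₃.exists_pull_eq y
    refine ⟨IsFiltered.max j k, f' ≫ σ.diag.map (IsFiltered.leftToMax j k) +
      (S.g ≫ g) ≫ σ.diag.map (IsFiltered.rightToMax j k), ?_⟩
    simp [hy]
  · obtain ⟨j, a, ha⟩ := h₁.exists_comp_map_eq_zero (f := S.f ≫ f) (by
      rw [pull_comp, hf, map_zero])
    obtain ⟨g, hg⟩ : ∃ g, S.g ≫ g = f ≫ σ.diag.map a :=
      ⟨_, (CokernelCofork.IsColimit.desc' hS.gIsCokernel (f ≫ σ.diag.map a)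
        (by simpa using ha)).2⟩
    obtain ⟨k, b, hb⟩ := h₃.exists_comp_map_eq_zero (f := g) (pull_injective F S.g (by
      rw [← pull_comp, hg, pull_comp, pull_elt, hf, map_zero]))
    exact ⟨k, a ≫ b, by
      rw [Functor.map_comp, ← Category.assoc, ← hg, Category.assoc, hb, comp_zero]⟩

end Closure

section Colimits

variable {F : Aᵒᵖ ⥤ AddCommGrpCat.{w}} {J : Type*} [Category* J] {σ : ElementSystem F J}

lemma Detects.of_isColimit_discrete [HasZeroMorphisms A] {α : Cardinal.{w}} [Fact α.IsRegular]
    [IsCardinalFiltered J α] {I : Type w} (hI : HasCardinalLT I α)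
    [PreservesLimitsOfShape (Discrete I) F] {D : Discrete I ⥤ A} {c : Cocone D} (hc : IsColimit c)
    (hD : ∀ i, σ.Detects (D.obj i)) : σ.Detects c.pt := by
  replace hI : HasCardinalLT (Discrete I) α := (hasCardinalLT_iff_of_equiv discreteEquiv _).2 hI
  refine ⟨fun x => ?_, fun {i f} hf => ?_⟩
  · choose k f hf using fun i => (hD i).exists_pull_eq (pull F (c.ι.app i) x)
    let g : c.pt ⟶ σ.diag.obj (IsCardinalFiltered.max k hI) := hc.desc (Cocone.mk _
      (Discrete.natTrans fun i => f i ≫ σ.diag.map (IsCardinalFiltered.toMax k hI i)))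
    have hg (i) : c.ι.app i ≫ g = f i ≫ σ.diag.map (IsCardinalFiltered.toMax k hI i) :=
      hc.fac _ i
    refine ⟨_, g, pull_ext_of_isColimit_discrete F hc fun i => ?_⟩
    rw [← pull_comp, hg, pull_comp, pull_elt, hf]
  · choose k a ha using fun l => (hD l).exists_comp_map_eq_zero (f := c.ι.app l ≫ f) (by
      rw [pull_comp, hf, map_zero])
    obtain ⟨m, b, a', hb⟩ := IsCardinalFiltered.wideSpan a hI
    refine ⟨m, a', hc.hom_ext fun l => ?_⟩
    rw [← hb l, Functor.map_comp, ← Category.assoc, ← Category.assoc, ha, zero_comp, comp_zero]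

lemma IsExhaustive.detects [Preadditive A] [F.Additive] [F.PreservesMonomorphisms]
    {Q : ObjectProperty A} (hσ : σ.IsExhaustive Q) {K : Type w} [SmallCategory K]
    [PreservesLimitsOfShape (Discrete K) F] {X : A} (p : Q.ColimitOfShape K X)
    [HasCoproduct p.diag.obj] : σ.Detects X := by
  refine ⟨fun x => ?_, fun {i f} hf => ?_⟩
  · obtain ⟨i, hi⟩ := hσ.exists_forall_pull_eq
    obtain ⟨j, a, ha⟩ := hσ.exists_forall_comp_map_eq_zero i
    choose f hf using fun k => hi (p.prop_diag_obj k) (pull F (p.ι.app k) x)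
    have comp_eq {k l : K} (u : k ⟶ l) :
        (p.diag.map u ≫ f l) ≫ σ.diag.map a = f k ≫ σ.diag.map a := by
      rw [← sub_eq_zero, ← Preadditive.sub_comp]
      refine ha (p.prop_diag_obj k) _ ?_
      rw [pull_sub_hom, pull_comp, hf, hf, ← pull_comp, p.ι.naturality]
      simp
    let g : X ⟶ σ.diag.obj j := p.isColimit.desc (Cocone.mk _
      { app := fun k => f k ≫ σ.diag.map a
        naturality := fun k l u => by simpa using comp_eq u })
    have hg (k) : p.ι.app k ≫ g = f k ≫ σ.diag.map a := p.isColimit.fac _ k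
    refine ⟨j, g, pull_ext_of_isColimit F p.isColimit fun k => ?_⟩
    dsimp only [ColimitPresentation.cocone]
    rw [← pull_comp, hg, pull_comp, pull_elt, hf]
  · obtain ⟨j, a, ha⟩ := hσ.exists_forall_comp_map_eq_zero i
    refine ⟨j, a, p.isColimit.hom_ext fun k => ?_⟩
    rw [comp_zero, ← Category.assoc]
    exact ha (p.prop_diag_obj k) _ ((pull_comp F _ _ _).trans (by rw [hf, map_zero]))

end Colimits

lemma exists_iso_preadditiveYoneda [Preadditive A] [IsIdempotentComplete A]
    {F : Aᵒᵖ ⥤ AddCommGrpCat.{w}} [F.Additive] {J : Type*} [Category* J] {σ : ElementSystem F J}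
    (hσ : ∀ X, σ.Detects X) (h : σ.IsAmalgamated) :
    ∃ Z : A, Nonempty (F ≅ preadditiveYoneda.obj Z) := by
  obtain ⟨c, t, ht⟩ := h
  obtain ⟨i, f, hf⟩ := (hσ c.pt).exists_pull_eq t
  refine exists_iso_preadditiveYoneda_of_surjective t (fun X x => ?_) (f ≫ c.ι.app i)
    (by rw [pull_comp, ht, hf]) fun {X} g hg => ?_
  · obtain ⟨j, g, rfl⟩ := (hσ X).exists_pull_eq x
    exact ⟨g ≫ c.ι.app j, by rw [pull_comp, ht]⟩
  · obtain ⟨j, a, ha⟩ := (hσ X).exists_comp_map_eq_zero (f := g ≫ f) (by rw [pull_comp, hf, hg])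
    rw [← c.w a, ← Category.assoc, ← Category.assoc, ha, zero_comp]

end ElementSystem

section Elements

variable {F : Aᵒᵖ ⥤ AddCommGrpCat.{w}} {P Q : ObjectProperty A}

/-- The restriction of `F` to a full subcategory, as a presheaf of sets. -/
abbrev restrict (F : Aᵒᵖ ⥤ AddCommGrpCat.{w}) (P : ObjectProperty A) :
    P.FullSubcategoryᵒᵖ ⥤ Type w :=
  P.ι.op ⋙ F ⋙ forget AddCommGrpCat

/-- The category of elements of `F` over the objects of `P`: a morphism `(X, x) ⟶ (Y, y)` is a
morphism `f : X ⟶ Y` with `pull F f y = x`. -/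
abbrev ElementsOver (F : Aᵒᵖ ⥤ AddCommGrpCat.{w}) (P : ObjectProperty A) :=
  (restrict F P).Elementsᵒᵖ

namespace ElementsOver

/-- The object `(X, x)` of the category of elements. -/
abbrev mk {X : A} (hX : P X) (x : F.obj (op X)) : ElementsOver F P := op ⟨op ⟨X, hX⟩, x⟩

/-- The forgetful functor from the category of elements. -/
abbrev forget (F : Aᵒᵖ ⥤ AddCommGrpCat.{w}) (P : ObjectProperty A) : ElementsOver F P ⥤ A :=
  (CategoryOfElements.π (restrict F P)).leftOp ⋙ P.ι

/-- The element underlying an object of the category of elements. -/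
abbrev elt (e : ElementsOver F P) : F.obj (op ((forget F P).obj e)) := e.unop.2

lemma prop_forget_obj (e : ElementsOver F P) : P ((forget F P).obj e) := e.unop.1.unop.property

lemma pull_forget_map {e e' : ElementsOver F P} (a : e ⟶ e') :
    pull F ((forget F P).map a) e'.elt = e.elt :=
  a.unop.2

/-- The morphism `(X, x) ⟶ (Y, y)` given by a morphism `f` with `pull F f y = x`. -/
abbrev homMk {e e' : ElementsOver F P} (f : (forget F P).obj e ⟶ (forget F P).obj e')
    (hf : pull F f e'.elt = e.elt) : e ⟶ e' :=
  Quiver.Hom.op ⟨Quiver.Hom.op (ObjectProperty.homMk f), hf⟩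

end ElementsOver

open ElementsOver

lemma preservesLimits_restrict [PreservesFiniteLimits F]
    [∀ I : Type w, PreservesLimitsOfShape (Discrete I) F] (hP : IsCocompleteSubcategory P) :
    PreservesLimitsOfSize.{w, w} (restrict F P) := by
  have := hP.hasColimits
  have := hP.preservesColimits_ι
  have : PreservesLimitsOfSize.{w, w} P.ι.op := preservesLimitsOfSize_op _
  have : PreservesLimitsOfSize.{0, 0} P.ι.op := preservesLimitsOfSize_shrink.{0, w, 0, w} _
  have : HasColimitsOfSize.{0, 0} P.FullSubcategory := hasColimitsOfSizeShrink.{0, 0, w, w} _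
  have : HasCoproducts.{w} P.FullSubcategory := fun _ => inferInstance
  have : PreservesLimitsOfSize.{w, w} (P.ι.op ⋙ F) :=
    preservesLimits_of_preservesEqualizers_and_products _
  exact inferInstanceAs
    (PreservesLimitsOfSize.{w, w} ((P.ι.op ⋙ F) ⋙ CategoryTheory.forget AddCommGrpCat))

lemma ElementsOver.hasColimits [PreservesFiniteLimits F]
    [∀ I : Type w, PreservesLimitsOfShape (Discrete I) F] (hP : IsCocompleteSubcategory P) :
    HasColimitsOfSize.{w, w} (ElementsOver F P) := by
  have := preservesLimits_restrict (F := F) hP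
  have := hP.hasColimits
  have : HasLimitsOfSize.{w, w} (restrict F P).Elements := ⟨fun _ _ => inferInstance⟩
  infer_instance

lemma ElementsOver.exists_forall_nonempty_hom [HasColimitsOfSize.{w, w} (ElementsOver F P)]
    [ObjectProperty.Small.{w} Q] (hQP : Q ≤ P) :
    ∃ e : ElementsOver F P, ∀ ⦃X : A⦄ (hX : Q X) (x : F.obj (op X)),
      Nonempty (mk (hQP X hX) x ⟶ e) := by
  let ι := Σ X : Subtype Q, F.obj (op X.1)
  let G (i : Shrink.{w} ι) : ElementsOver F P :=
    mk (hQP _ ((equivShrink ι).symm i).1.2) ((equivShrink ι).symm i).2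
  refine ⟨∐ G, fun X hX x => ?_⟩
  obtain ⟨i, hi⟩ := (equivShrink ι).symm.surjective ⟨⟨X, hX⟩, x⟩
  have : Nonempty (mk (hQP _ ((equivShrink ι).symm i).1.2) ((equivShrink ι).symm i).2 ⟶ ∐ G) :=
    ⟨Sigma.ι G i⟩
  rwa [hi] at this

/-- The morphisms `(X, x) ⟶ (Y, y)` of elements with `Y` injective such that all morphisms from
objects of `Q` to `X` that induce `0` from `x` become zero in `Y`. -/
def absorbing [HasZeroMorphisms A] (F : Aᵒᵖ ⥤ AddCommGrpCat.{w}) (P Q : ObjectProperty A) :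
    MorphismProperty (ElementsOver F P) :=
  fun e e' a => Injective ((forget F P).obj e') ∧
    ∀ ⦃X : A⦄, Q X → ∀ f : X ⟶ (forget F P).obj e, pull F f e.elt = 0 →
      f ≫ (forget F P).map a = 0

lemma exists_pull_eq_zero_forall_exists_comp_eq [ObjectProperty.Small.{w} Q]
    [∀ I : Type w, PreservesLimitsOfShape (Discrete I) F] (hP : IsCocompleteSubcategory P)
    (hQP : Q ≤ P) {C : A} (c : F.obj (op C)) :
    ∃ (B : A) (d : B ⟶ C), P B ∧ pull F d c = 0 ∧
      ∀ ⦃X : A⦄, Q X → ∀ f : X ⟶ C, pull F f c = 0 → ∃ g : X ⟶ B, g ≫ d = f := by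
  let ι := Σ X : Subtype Q, { f : X.1 ⟶ C // pull F f c = 0 }
  let G (i : Shrink.{w} ι) : A := ((equivShrink ι).symm i).1.1
  let φ (i : Shrink.{w} ι) : G i ⟶ C := ((equivShrink ι).symm i).2.1
  have hG (i) : P (G i) := hQP _ ((equivShrink ι).symm i).1.2
  have hφ (i) : pull F (φ i) c = 0 := ((equivShrink ι).symm i).2.2
  have := hP.isClosedUnderColimitsOfShape (Discrete (Shrink.{w} ι))
  have : HasCoproduct G := hP.hasColimit _ fun i => hG i.as
  refine ⟨∐ G, Sigma.desc φ, P.prop_colimit _ fun i => hG i.as,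
    pull_ext_of_isColimit_discrete F (coproductIsCoproduct G) fun i => ?_, fun X hX f hf => ?_⟩
  · rw [map_zero, ← pull_comp]
    exact (congrArg (pull F · c) (Sigma.ι_desc φ i.as)).trans (hφ i.as)
  · obtain ⟨i, hi⟩ := (equivShrink ι).symm.surjective ⟨⟨X, hX⟩, f, hf⟩
    have : ∃ g : ((equivShrink ι).symm i).1.1 ⟶ ∐ G,
        g ≫ Sigma.desc φ = ((equivShrink ι).symm i).2.1 := ⟨Sigma.ι G i, Sigma.ι_desc φ i⟩
    rwa [hi] at this

lemma exists_absorbing [Abelian A] [F.Additive] [PreservesFiniteLimits F]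
    [PreservesFiniteColimits F] [∀ I : Type w, PreservesLimitsOfShape (Discrete I) F]
    [ObjectProperty.Small.{w} Q] (hP : IsCocompleteSubcategory P) (hQP : Q ≤ P)
    (hinj : ∀ X : A, P X → ∃ (S : A) (f : X ⟶ S), P S ∧ Injective S ∧ Mono f)
    (e : ElementsOver F P) : ∃ (e' : ElementsOver F P) (a : e ⟶ e'), absorbing F P Q a := by
  obtain ⟨B, d, hB, hd, hfac⟩ := exists_pull_eq_zero_forall_exists_comp_eq hP hQP e.elt
  have exact_d : (ShortComplex.mk d (cokernel.π d) (cokernel.condition d)).Exact :=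
    ShortComplex.exact_of_g_is_cokernel _ (cokernelIsCokernel d)
  obtain ⟨q, hq⟩ := exists_pull_eq_of_exact F exact_d hd
  obtain ⟨S, m, hS, hSinj, _⟩ := hinj _ (hP.prop_cokernel d hB e.prop_forget_obj)
  obtain ⟨s, rfl⟩ := pull_surjective F m q
  refine ⟨mk hS s, homMk (cokernel.π d ≫ m) ((pull_comp F _ _ _).trans hq), hSinj,
    fun X hX f hf => ?_⟩
  obtain ⟨g, rfl⟩ := hfac hX f hf
  change (g ≫ d) ≫ cokernel.π d ≫ m = 0
  rw [Category.assoc, cokernel.condition_assoc, zero_comp, comp_zero]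

end Elements

section Chain

lemma exists_transfiniteCompositionOfShape {C : Type*} [Category* C] {W : MorphismProperty C}
    (hW : ∀ X : C, ∃ (Y : C) (f : X ⟶ Y), W f) (J : Type*) [LinearOrder J] [OrderBot J]
    [SuccOrder J] [WellFoundedLT J] [HasIterationOfShape J C] (X : C) :
    ∃ (Y : C) (f : X ⟶ Y), Nonempty (W.TransfiniteCompositionOfShape J f) := by
  choose succ toSucc h using hW
  let Φ : SmallObject.SuccStruct C := ⟨X, succ, toSucc⟩
  have hΦ : Φ.prop ≤ W := by
    rintro _ _ _ ⟨⟩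
    exact h _
  exact ⟨_, _, ⟨(Φ.transfiniteCompositionOfShapeιIteration J).ofLE hΦ⟩⟩

variable {F : Aᵒᵖ ⥤ AddCommGrpCat.{w}} {P Q : ObjectProperty A}

namespace ElementSystem

/-- The system given by a diagram in the category of elements of `F` over the objects of `P`. -/
abbrev ofElements {J : Type*} [Category* J] (Ψ : J ⥤ ElementsOver F P) : ElementSystem F J where
  diag := Ψ ⋙ ElementsOver.forget F P
  elt j := (Ψ.obj j).elt
  pull_elt a := ElementsOver.pull_forget_map (Ψ.map a)

lemma isAmalgamated_ofElements {J : Type*} [Category* J] {Ψ : J ⥤ ElementsOver F P}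
    (c : Cocone Ψ) : (ofElements Ψ).IsAmalgamated :=
  ⟨(ElementsOver.forget F P).mapCocone c, c.pt.elt, fun j =>
    ElementsOver.pull_forget_map (c.ι.app j)⟩

section

variable [HasZeroMorphisms A] {J : Type*} [LinearOrder J] [OrderBot J] [SuccOrder J]
  [WellFoundedLT J] [NoMaxOrder J] {e e' : ElementsOver F P} {a : e ⟶ e'}

lemma hasCofinalInjectives_ofElements (h : (absorbing F P Q).TransfiniteCompositionOfShape J a) :
    (ofElements h.F).HasCofinalInjectives :=
  fun j => ⟨Order.succ j, homOfLE (Order.le_succ j), (h.map_mem j (not_isMax j)).1⟩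

lemma isExhaustive_ofElements (h : (absorbing F P Q).TransfiniteCompositionOfShape J a)
    (hQP : Q ≤ P) (he : ∀ ⦃X : A⦄ (hX : Q X) (x : F.obj (op X)),
      Nonempty (ElementsOver.mk (hQP X hX) x ⟶ e)) :
    (ofElements h.F).IsExhaustive Q where
  exists_forall_pull_eq := by
    refine ⟨⊥, fun X hX x => ?_⟩
    obtain ⟨b⟩ := he hX x
    exact ⟨_, ElementsOver.pull_forget_map (b ≫ h.isoBot.inv)⟩
  exists_forall_comp_map_eq_zero j :=
    ⟨Order.succ j, homOfLE (Order.le_succ j), (h.map_mem j (not_isMax j)).2⟩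

end

lemma exists_isExhaustive [Abelian A] [F.Additive] [PreservesFiniteLimits F]
    [PreservesFiniteColimits F] [∀ I : Type w, PreservesLimitsOfShape (Discrete I) F]
    [ObjectProperty.Small.{w} Q] (hP : IsCocompleteSubcategory P) (hQP : Q ≤ P)
    (hinj : ∀ X : A, P X → ∃ (S : A) (f : X ⟶ S), P S ∧ Injective S ∧ Mono f)
    (α : Cardinal.{w}) [hα : Fact α.IsRegular] :
    ∃ (J : Type w) (_ : SmallCategory J) (_ : IsCardinalFiltered J α) (σ : ElementSystem F J),
      σ.HasCofinalInjectives ∧ σ.IsExhaustive Q ∧ σ.IsAmalgamated := by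
  have : NoMaxOrder α.ord.ToType := Cardinal.noMaxOrder hα.out.aleph0_le
  have : Nonempty α.ord.ToType := IsCardinalFiltered.nonempty _ α
  let : OrderBot α.ord.ToType := WellFoundedLT.toOrderBot _
  let : SuccOrder α.ord.ToType := SuccOrder.ofLinearWellFoundedLT _
  have := ElementsOver.hasColimits (F := F) hP
  obtain ⟨e, he⟩ := ElementsOver.exists_forall_nonempty_hom (F := F) hQP
  obtain ⟨_, _, ⟨h⟩⟩ := exists_transfiniteCompositionOfShape
    (exists_absorbing hP hQP hinj) α.ord.ToType e
  exact ⟨α.ord.ToType, inferInstance, inferInstance, ofElements h.F,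
    hasCofinalInjectives_ofElements h, isExhaustive_ofElements h hQP he,
    isAmalgamated_ofElements (colimit.cocone h.F)⟩

lemma detects_of_isWeaklyGeneratedBelow [Abelian A] [F.Additive] [PreservesFiniteLimits F]
    [PreservesFiniteColimits F] [∀ I : Type w, PreservesLimitsOfShape (Discrete I) F]
    {α : Cardinal.{w}} [Fact α.IsRegular] {J : Type*} [Category* J] [IsCardinalFiltered J α]
    {σ : ElementSystem F J} (hσ : σ.HasCofinalInjectives) (hσQ : σ.IsExhaustive Q)
    (hP : IsCocompleteSubcategory P) (hQP : Q ≤ P)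
    (hgen : IsWeaklyGeneratedBelow (smallColimits Q) α) (X : A) : σ.Detects X := by
  have := isFiltered_of_isCardinalFiltered J α
  refine hgen σ.Detects ?colimits ⟨?kernels⟩ ⟨?cokernels⟩ ⟨.of_shortExact hσ⟩
    (fun I hI => ⟨?coproducts⟩) X
  case colimits =>
    rintro X ⟨K, _, ⟨p⟩⟩
    have : HasCoproduct p.diag.obj := hP.hasColimit _ fun k => hQP _ (p.prop_diag_obj k.as)
    exact hσQ.detects p
  case kernels =>
    rintro _ ⟨f, k, hk, hf⟩
    exact .of_isLimit_kernelFork hσ hk hf.1 hf.2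
  case cokernels =>
    rintro _ ⟨f, k, hk, hf⟩
    exact .of_isColimit_cokernelCofork hk hf.1 hf.2
  case coproducts =>
    rintro X ⟨p⟩
    exact .of_isColimit_discrete hI p.isColimit p.prop_diag_obj

end ElementSystem

end Chain

theorem exists_iso_preadditiveYoneda_of_isWeaklyGeneratedBelow [Abelian A]
    {P Q : ObjectProperty A} [ObjectProperty.Small.{w} Q] (hP : IsCocompleteSubcategory P)
    (hQP : Q ≤ P) (hinj : ∀ X : A, P X → ∃ (S : A) (f : X ⟶ S), P S ∧ Injective S ∧ Mono f)
    {α : Cardinal.{w}} [Fact α.IsRegular] (hgen : IsWeaklyGeneratedBelow (smallColimits Q) α)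
    (F : Aᵒᵖ ⥤ AddCommGrpCat.{w}) [PreservesFiniteLimits F] [PreservesFiniteColimits F]
    [∀ I : Type w, PreservesLimitsOfShape (Discrete I) F] :
    ∃ Z : A, Nonempty (F ≅ preadditiveYoneda.obj Z) := by
  have : F.Additive := Functor.additive_of_preserves_binary_products F
  obtain ⟨J, _, _, σ, hσ, hσQ, hamalg⟩ :=
    ElementSystem.exists_isExhaustive (F := F) hP hQP hinj α
  exact ElementSystem.exists_iso_preadditiveYoneda
    (ElementSystem.detects_of_isWeaklyGeneratedBelow hσ hσQ hP hQP hgen) hamalg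

end QuasiLocPres

open CategoryTheory CategoryTheory.Limits QuasiLocPres in
theorem theorem2p3_general {A : Type u} [Category.{w} A] [Abelian A]
    (𝒜 : Cardinal.{w} → ObjectProperty A) (hA : IsQuasiLocallyPresentable 𝒜)
    (κ : Cardinal.{w}) [Fact κ.IsRegular] (hinc : IsIncreasingFrom 𝒜 κ)
    (α : Cardinal.{w}) [Fact α.IsRegular] (hgen : IsWeaklyGeneratedBelow (𝒜 κ) α)
    (hinj : ∀ (μ : Cardinal.{w}) [Fact μ.IsRegular], κ ≤ μ →
      ∀ X : A, presentablePart 𝒜 μ X → ∃ (S : A) (f : X ⟶ S), injectivePart 𝒜 μ S ∧ Mono f)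
    (F : Aᵒᵖ ⥤ AddCommGrpCat.{w}) [PreservesFiniteLimits F] [PreservesFiniteColimits F]
    (hF : ∀ I : Type w, PreservesLimitsOfShape (Discrete I) F) :
    (∃ Z : A, Nonempty (F ≅ preadditiveYoneda.obj Z)) ∧
      ∀ Z : A, Nonempty (F ≅ preadditiveYoneda.obj Z) → Injective Z := by
  refine ⟨?_, fun Z ⟨e⟩ => injective_of_iso_preadditiveYoneda e⟩
  obtain ⟨Q, _, hQ, hcolim⟩ := hA.exists_small_le_smallColimits (κ := κ)
  refine exists_iso_preadditiveYoneda_of_isWeaklyGeneratedBelow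
    (isCocompleteSubcategory_eventuallyPresentable hA hinc)
    (hQ.trans (presentablePart_le_eventuallyPresentable le_rfl)) ?_ (hgen.mono hcolim) F
  rintro X ⟨μ, _, hμ, hX⟩
  obtain ⟨S, f, ⟨hSinj, hS⟩, hf⟩ := hinj μ hμ X hX
  exact ⟨S, f, presentablePart_le_eventuallyPresentable hμ _ hS, hSinj, hf⟩

open CategoryTheory CategoryTheory.Limits in
theorem theorem2p3 {A : Type u} [Category.{w} A] [Abelian A]
    (𝒜 : Cardinal.{w} → ObjectProperty A)
    (hA : QuasiLocPres.IsQuasiLocallyPresentable 𝒜)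
    (κ : Cardinal.{w}) [Fact κ.IsRegular]
    (hinc : ∀ (μ ν : Cardinal.{w}) [Fact μ.IsRegular] [Fact ν.IsRegular], κ ≤ μ → μ ≤ ν →
      QuasiLocPres.presentablePart 𝒜 μ ≤ QuasiLocPres.presentablePart 𝒜 ν)
    (hgen : QuasiLocPres.IsWeaklyGenerated 𝒜 κ)
    (hinj : ∀ (μ : Cardinal.{w}) [Fact μ.IsRegular], κ ≤ μ →
      ∀ X : A, QuasiLocPres.presentablePart 𝒜 μ X →
        ∃ (S : A) (f : X ⟶ S), QuasiLocPres.injectivePart 𝒜 μ S ∧ Mono f)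
    (F : Aᵒᵖ ⥤ AddCommGrpCat.{w}) [PreservesFiniteLimits F] [PreservesFiniteColimits F]
    (hF : ∀ I : Type w, PreservesLimitsOfShape (Discrete I) F) :
    (∃ Z : A, Nonempty (F ≅ preadditiveYoneda.obj Z)) ∧
      ∀ Z : A, Nonempty (F ≅ preadditiveYoneda.obj Z) → Injective Z := by
  have : Fact (Cardinal.aleph.{w} 1).IsRegular := ⟨Cardinal.isRegular_aleph_one⟩
  exact theorem2p3_general 𝒜 hA κ hinc _ hgen.isWeaklyGeneratedBelow_aleph_one hinj F hF
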